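/- Let $I=[a,b)$ be a bounded real interval with $a<b$. Let $\mathcal D_0(I)=\{I\}$, let $\mathcal D_{k+1}(I)$ consist of the left and right halves of the intervals in $\mathcal D_k(I)$, and let $\mathcal D(I)=\bigcup_{k\ge 0}\mathcal D_k(I)$. Let $\mathfrak S_2(I)$ denote the set of all $2$-Carleson binary sequences adapted to $I$, i.e. all $\alpha=\{\alpha_J\}_{J\in\mathcal D(I)}$ with $\alpha_J\in\{0,1\}$ and $$\sup_{J\in\mathcal D(I)}\frac1{|J|}\sum_{K\in\mathcal D(J)}\alpha_K|K|\le 2 .$$ For $p\ge 1$, $\alpha\in\mathfrak S_2(I)$ and $f\in L^p(I)$ define the power-mean sparse operator $$\mathcal Q_{\alpha,p}f(t)=\sum_{J\in\mathcal D(I)}\alpha_J\,\langle |f|^p\rangle_J^{1/p}\,\mathbf 1_J(t),\qquad \langle g\rangle_J=\frac1{|J|}\int_J g(t)\,dt ,$$ with values in $[0,\infty]$, and let $\|\mathcal Q_{\alpha,p}\|_{(p,p)}=\|\mathcal Q_{\alpha,p}:L^p(I)\to L^{p,\infty}(I)\|$ be its weak-type norm, i.e. the smallest constant $c\in[0,\infty]$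 such that $$\lambda\,\big|\{t\in I:\mathcal Q_{\alpha,p}f(t)\ge\lambda\}\big|^{1/p}\le c\,\Big(\int_I|f(t)|^p\,dt\Big)^{1/p}\qquad\text{for all } f\in L^p(I)\text{ and all }\lambda>0 .$$ For $r>0$ put $C(r)=\Big(\dfrac{2^{r+1}-1}{2^r-1}\Big)^{1/r}$. Then, for every real $p\ge1$, $$\sup_{\alpha\in\mathfrak S_2(I)}\|\mathcal Q_{\alpha,p}\|_{(p,p)}=C(1/p)^{1/p}=\frac{2\cdot2^{1/p}-1}{2^{1/p}-1}.$$ -/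

import Mathlib

open MeasureTheory Set
open scoped ENNReal

noncomputable section

namespace PowerMeanSparse

/-- An interval is given by its endpoints: `J` stands for the half-open interval `[J.1, J.2)`. -/
abbrev Interval : Type := ℝ × ℝ

/-- The half-open interval `[J.1, J.2)` as a set of reals. -/
def Interval.toSet (J : Interval) : Set ℝ := Ico J.1 J.2

/-- The length `|J|`. -/
def Interval.len (J : Interval) : ℝ≥0∞ := ENNReal.ofReal (J.2 - J.1)

/-- The left half `J₋`. -/
def Interval.left (J : Interval) : Interval := (J.1, (J.1 + J.2) / 2)

/-- The right half `J₊`. -/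
def Interval.right (J : Interval) : Interval := ((J.1 + J.2) / 2, J.2)

/-- The `k`-th dyadic generation `𝒟ₖ(I)`. -/
def dyadicGen (I : Interval) : ℕ → Set Interval
  | 0 => {I}
  | k + 1 => ⋃ J ∈ dyadicGen I k, {Interval.left J, Interval.right J}

/-- The dyadic lattice `𝒟(I) = ⋃ₖ 𝒟ₖ(I)`. -/
def dyadic (I : Interval) : Set Interval := ⋃ k : ℕ, dyadicGen I k

/-- `A(α; J) = |J|⁻¹ ∑_{K ∈ 𝒟(J)} α_K |K|`. -/
def packing (α : Interval → ℕ) (J : Interval) : ℝ≥0∞ :=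
  (∑' K : dyadic J, (α K : ℝ≥0∞) * Interval.len K) / Interval.len J

/-- The set `𝔖_C(I)` of `C`-Carleson binary sequences adapted to `I`. A sequence is written as a
function on all intervals; only its values on `𝒟(I)` are ever used. -/
def carleson (C : ℝ≥0∞) (I : Interval) : Set (Interval → ℕ) :=
  {α | (∀ J ∈ dyadic I, α J = 0 ∨ α J = 1) ∧ (⨆ J ∈ dyadic I, packing α J) ≤ C}

/-- The average `⟨g⟩_J = |J|⁻¹ ∫_J g` of a function `g ≥ 0`. -/
def average (g : ℝ → ℝ≥0∞) (J : Interval) : ℝ≥0∞ :=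
  (∫⁻ t in Interval.toSet J, g t) / Interval.len J

/-- The power-mean sparse operator
`𝒬_{α,p} f (t) = ∑_{J ∈ 𝒟(I)} α_J ⟨|f|^p⟩_J^{1/p} 1_J(t)`, with values in `[0, ∞]`. -/
def powerMeanSparse (I : Interval) (α : Interval → ℕ) (p : ℝ) (f : ℝ → ℝ) (t : ℝ) : ℝ≥0∞ :=
  ∑' J : dyadic I, (α J : ℝ≥0∞) * average (fun s => ‖f s‖ₑ ^ p) J ^ (1 / p) *
    (Interval.toSet J).indicator 1 t

/-- The weak quasi-norm of `L^{p,∞}(I)`: `sup_{l > 0} l · |{t ∈ I : g(t) ≥ l}|^{1/p}`. -/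
def weakNorm (I : Interval) (p : ℝ) (g : ℝ → ℝ≥0∞) : ℝ≥0∞ :=
  ⨆ (l : ℝ) (_ : 0 < l),
    ENNReal.ofReal l * volume {t ∈ Interval.toSet I | ENNReal.ofReal l ≤ g t} ^ (1 / p)

/-- The weak-type norm `‖T : L^p(I) → L^{p,∞}(I)‖`: the optimal constant `c ∈ [0, ∞]` in
`‖T f‖_{L^{p,∞}(I)} ≤ c ‖f‖_{L^p(I)}`, `f ∈ L^p(I)`. -/
def weakTypeNorm (I : Interval) (p : ℝ) (T : (ℝ → ℝ) → ℝ → ℝ≥0∞) : ℝ≥0∞ :=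
  sInf {c : ℝ≥0∞ | ∀ f : ℝ → ℝ,
    MemLp f (ENNReal.ofReal p) (volume.restrict (Interval.toSet I)) →
      weakNorm I p (T f) ≤
        c * eLpNorm f (ENNReal.ofReal p) (volume.restrict (Interval.toSet I))}

/-- `C(r) = ((2^{r+1} - 1) / (2^r - 1))^{1/r}`. -/
def sharpConst (r : ℝ) : ℝ := (((2 : ℝ) ^ (r + 1) - 1) / ((2 : ℝ) ^ r - 1)) ^ (1 / r)

end PowerMeanSparse

end


/-!
For the upper bound, put `x = ∫_J |f|^p` and `A = ∑_{K ∈ 𝒟(J)} α_K |K|`, and bound the measure of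
`{t ∈ J | l ≤ 𝒬f(t)}` by `B(l, x, A) = ((1 + m) / (l x^{-1/p} + m A^{-1/p}))^p`, going from short
intervals to long ones. From the two halves to `J` the pairs `(x, A)` add up, and `B(l, ·, ·)` is
superadditive by Radon's inequality. If `α_J = 1`, the level drops by `(x / |J|)^{1/p}` and `A`
grows by `|J|`; since the old value of `A` is at most `δ|J|` for a `(1 + δ)`-Carleson sequence, `B`
does not decrease as soon as `m = δ^{1/p} + m (δ / (1 + δ))^{1/p}`. Dropping `A` from `B` leaves the
weak-type bound with constant `1 + m`.

For `δ = 1` we have `m = ∑ₖ 2^{-k/p}`. The bound `1 + m` is approached by the sequence supported on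
`I`, its first `n` successive left halves and both halves of the last of them, tested on the
indicator of that last left half: there `𝒬f` is at least `1 + ∑_{k ≤ n} 2^{-k/p}`.
-/

namespace PowerMeanSparse

lemma radon_inequality {r : ℝ} (hr : 0 < r) (s t x y : ℝ≥0∞) :
    (s + t) ^ (1 + r) / (x + y) ^ r ≤ s ^ (1 + r) / x ^ r + t ^ (1 + r) / y ^ r := by
  have hr' : 0 < 1 + r := by positivity
  rcases eq_or_ne x 0 with rfl | hx
  · rcases eq_or_ne s 0 with rfl | hs
    · simp [hr']
    · simp [ENNReal.zero_rpow_of_pos hr, ENNReal.div_zero, hs, hr'.not_gt]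
  rcases eq_or_ne y 0 with rfl | hy
  · rcases eq_or_ne t 0 with rfl | ht
    · simp [hr']
    · simp [ENNReal.zero_rpow_of_pos hr, ENNReal.div_zero, ht, hr'.not_gt]
  rcases eq_or_ne (x + y) ∞ with hxy | hxy
  · simp [hxy, ENNReal.top_rpow_of_pos hr]
  have hxy₀ : x + y ≠ 0 := by simp [hx]
  obtain ⟨hx', hy'⟩ := ENNReal.add_ne_top.1 hxy
  have scale {u v : ℝ≥0∞} (hv : v ≠ 0) (hv' : v ≠ ∞) :
      v * (u / v) ^ (1 + r) = u ^ (1 + r) / v ^ r := by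
    rw [ENNReal.div_rpow_of_nonneg _ _ hr'.le, ENNReal.rpow_add _ _ hv hv', ENNReal.rpow_one,
      ← mul_div_assoc, ENNReal.mul_div_mul_left _ _ hv hv']
  have jensen := ENNReal.rpow_arith_mean_le_arith_mean2_rpow (x / (x + y)) (y / (x + y))
    (s / x) (t / y) (by rw [← ENNReal.add_div, ENNReal.div_self hxy₀ hxy])
    (le_add_of_nonneg_right hr.le)
  calc (s + t) ^ (1 + r) / (x + y) ^ r
      = (x + y) * (s / x * (x / (x + y)) + t / y * (y / (x + y))) ^ (1 + r) := by
        rw [← scale hxy₀ hxy, ← mul_div_assoc, ENNReal.div_mul_cancel hx hx', ← mul_div_assoc,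
          ENNReal.div_mul_cancel hy hy', ENNReal.add_div]
    _ ≤ (x + y) * (x / (x + y) * (s / x) ^ (1 + r) + y / (x + y) * (t / y) ^ (1 + r)) := by
        rw [mul_comm (s / x), mul_comm (t / y)]; gcongr
    _ = x * (s / x) ^ (1 + r) + y * (t / y) ^ (1 + r) := by
        rw [mul_add, ← mul_assoc, ← mul_assoc, ENNReal.mul_div_cancel hxy₀ hxy,
          ENNReal.mul_div_cancel hxy₀ hxy]
    _ = s ^ (1 + r) / x ^ r + t ^ (1 + r) / y ^ r := by rw [scale hx hx', scale hy hy']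

/-- The Bellman function of the upper bound: for a suitable weight `m` it dominates the measure of
`{t ∈ J | l ≤ 𝒬f(t)}`, where `x = ∫_J |f|^p` and `A = ∑_{K ∈ 𝒟(J)} α_K |K|`. Both arguments are
integrals over `J` rather than averages, so that superadditivity takes the place of concavity. -/
noncomputable def bellman (p : ℝ) (m l x A : ℝ≥0∞) : ℝ≥0∞ :=
  ((1 + m) / (l / x ^ p⁻¹ + m / A ^ p⁻¹)) ^ p

section Bellman

variable {p : ℝ} {m : ℝ≥0∞}

lemma le_bellman_iff (hp : 0 < p) (hm : m ≠ ∞) {l x A v : ℝ≥0∞} :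
    v ≤ bellman p m l x A ↔ v ^ p⁻¹ * (l / x ^ p⁻¹ + m / A ^ p⁻¹) ≤ 1 + m := by
  rw [bellman, ← ENNReal.rpow_inv_le_iff hp,
    ENNReal.le_div_iff_mul_le (.inr (by simp)) (.inr (by simp [hm]))]

lemma bellman_mono (hp : 0 < p) (m l : ℝ≥0∞) {x y A B : ℝ≥0∞} (hxy : x ≤ y) (hAB : A ≤ B) :
    bellman p m l x A ≤ bellman p m l y B := by
  unfold bellman
  gcongr

lemma bellman_add_le (hp : 0 < p) (hm : m ≠ ∞) (l x A y B : ℝ≥0∞) :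
    bellman p m l x A + bellman p m l y B ≤ bellman p m l (x + y) (A + B) := by
  have hs : bellman p m l x A ≤ bellman p m l (x + y) (A + B) :=
    bellman_mono hp m l le_self_add le_self_add
  have ht : bellman p m l y B ≤ bellman p m l (x + y) (A + B) :=
    bellman_mono hp m l le_add_self le_add_self
  have hsx := (le_bellman_iff hp hm).1 (le_refl (bellman p m l x A))
  have hty := (le_bellman_iff hp hm).1 (le_refl (bellman p m l y B))
  set s := bellman p m l x A
  set t := bellman p m l y B
  rcases eq_or_ne (s + t) 0 with h₀ | h₀
  · simp [h₀]
  rcases eq_or_ne (s + t) ∞ with h | h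
  · rcases ENNReal.add_eq_top.1 h with h | h
    · simp [top_le_iff.1 (h ▸ hs)]
    · simp [top_le_iff.1 (h ▸ ht)]
  have hr : 0 < p⁻¹ := inv_pos.2 hp
  have rpow_one_add (v : ℝ≥0∞) : v ^ (1 + p⁻¹) = v * v ^ p⁻¹ := by
    rw [ENNReal.rpow_add_of_nonneg _ _ zero_le_one hr.le, ENNReal.rpow_one]
  rw [le_bellman_iff hp hm, ← ENNReal.mul_le_mul_iff_right h₀ h]
  calc (s + t) * ((s + t) ^ p⁻¹ * (l / (x + y) ^ p⁻¹ + m / (A + B) ^ p⁻¹))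
      = l * ((s + t) ^ (1 + p⁻¹) / (x + y) ^ p⁻¹) +
          m * ((s + t) ^ (1 + p⁻¹) / (A + B) ^ p⁻¹) := by
        rw [rpow_one_add]; simp only [div_eq_mul_inv]; ring
    _ ≤ l * (s ^ (1 + p⁻¹) / x ^ p⁻¹ + t ^ (1 + p⁻¹) / y ^ p⁻¹) +
          m * (s ^ (1 + p⁻¹) / A ^ p⁻¹ + t ^ (1 + p⁻¹) / B ^ p⁻¹) := by
        gcongr <;> exact radon_inequality hr _ _ _ _
    _ = s * (s ^ p⁻¹ * (l / x ^ p⁻¹ + m / A ^ p⁻¹)) +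
          t * (t ^ p⁻¹ * (l / y ^ p⁻¹ + m / B ^ p⁻¹)) := by
        rw [rpow_one_add, rpow_one_add]; simp only [div_eq_mul_inv]; ring
    _ ≤ s * (1 + m) + t * (1 + m) := by gcongr
    _ = (s + t) * (1 + m) := by ring

lemma mul_rpow_le_of_le_bellman (hp : 0 < p) (hm : m ≠ ∞) {l x A v : ℝ≥0∞}
    (h : v ≤ bellman p m l x A) : l * v ^ p⁻¹ ≤ (1 + m) * x ^ p⁻¹ := by
  have := (le_bellman_iff hp hm).1 h
  rw [← ENNReal.div_le_iff_le_mul (.inr (by simp [hm])) (.inr (by simp))]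
  calc l * v ^ p⁻¹ / x ^ p⁻¹ = v ^ p⁻¹ * (l / x ^ p⁻¹) := by rw [mul_comm, mul_div_assoc]
    _ ≤ v ^ p⁻¹ * (l / x ^ p⁻¹ + m / A ^ p⁻¹) := by gcongr; exact le_self_add
    _ ≤ 1 + m := this

lemma le_bellman_of_le (hp : 0 < p) (hm : m ≠ ∞) {l x A h : ℝ≥0∞} (hh : h ≠ 0)
    (hh' : h ≠ ∞) (hA : h ≤ A) (hl : l ≤ (x / h) ^ p⁻¹) : h ≤ bellman p m l x A := by
  have hr : 0 < p⁻¹ := inv_pos.2 hp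
  rw [le_bellman_iff hp hm, mul_add]
  gcongr
  · calc h ^ p⁻¹ * (l / x ^ p⁻¹) ≤ h ^ p⁻¹ * ((x / h) ^ p⁻¹ / x ^ p⁻¹) := by gcongr
      _ = x ^ p⁻¹ / x ^ p⁻¹ := by
        rw [← mul_div_assoc, ← ENNReal.mul_rpow_of_nonneg _ _ hr.le, ENNReal.mul_div_cancel hh hh']
      _ ≤ 1 := ENNReal.div_self_le_one
  · calc h ^ p⁻¹ * (m / A ^ p⁻¹) ≤ A ^ p⁻¹ * (m / A ^ p⁻¹) := by gcongr
      _ ≤ m := ENNReal.mul_div_le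

/-- The weight `m` solving `m = δ^{1/p} + m (δ / (1 + δ))^{1/p}`, which is what the jump of the
Bellman function at an interval with `α_J = 1` requires of a `(1 + δ)`-Carleson sequence. It is the
amount by which the weak-type bound exceeds `1`. -/
noncomputable def excess (p : ℝ) (δ : ℝ≥0∞) : ℝ≥0∞ :=
  δ ^ p⁻¹ / (1 - (δ / (1 + δ)) ^ p⁻¹)

lemma div_one_add_rpow_lt_one (hp : 0 < p) {δ : ℝ≥0∞} (hδ : δ ≠ ∞) : (δ / (1 + δ)) ^ p⁻¹ < 1 :=
  ENNReal.rpow_lt_one ((ENNReal.div_lt_iff (.inl (by simp)) (.inl (by simp [hδ]))).2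
    (by rw [one_mul, add_comm]; exact ENNReal.lt_add_right hδ one_ne_zero)) (inv_pos.2 hp)

lemma excess_ne_top (hp : 0 < p) {δ : ℝ≥0∞} (hδ : δ ≠ ∞) : excess p δ ≠ ∞ :=
  ENNReal.div_ne_top (ENNReal.rpow_ne_top_of_nonneg (inv_pos.2 hp).le hδ)
    (tsub_pos_of_lt (div_one_add_rpow_lt_one hp hδ)).ne'

lemma excess_ne_zero (hp : 0 < p) {δ : ℝ≥0∞} (hδ₀ : δ ≠ 0) : excess p δ ≠ 0 := by
  have : δ ^ p⁻¹ ≠ 0 := by simp [hδ₀, hp.le, hp]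
  exact ENNReal.div_ne_zero.2 ⟨this, by simp⟩

lemma rpow_add_excess_mul (hp : 0 < p) {δ : ℝ≥0∞} (hδ : δ ≠ ∞) :
    δ ^ p⁻¹ + excess p δ * (δ / (1 + δ)) ^ p⁻¹ = excess p δ := by
  have hq := div_one_add_rpow_lt_one hp hδ
  conv_rhs => rw [← mul_one (excess p δ), ← tsub_add_cancel_of_le hq.le, mul_add]
  rw [excess, ENNReal.div_mul_cancel (tsub_pos_of_lt hq).ne' (by simp)]

lemma inv_add_excess_div_le (hp : 0 < p) {δ A h : ℝ≥0∞} (hδ₀ : δ ≠ 0) (hδ : δ ≠ ∞)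
    (hh : h ≠ 0) (hh' : h ≠ ∞) (hA : A ≤ δ * h) :
    (h ^ p⁻¹)⁻¹ + excess p δ / (h + A) ^ p⁻¹ ≤ excess p δ / A ^ p⁻¹ := by
  have hr : 0 < p⁻¹ := inv_pos.2 hp
  have hA' : A ≠ ∞ := ne_top_of_le_ne_top (ENNReal.mul_ne_top hδ hh') hA
  have hratio : A / (h + A) ≤ δ / (1 + δ) := by
    rw [ENNReal.div_le_iff (by simp [hh]) (by simp [hh', hA']), div_eq_mul_inv, mul_right_comm,
     ← div_eq_mul_inv, ENNReal.le_div_iff_mul_le (by simp) (by simp [hδ])]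
    calc A * (1 + δ) = A + A * δ := by ring
      _ ≤ δ * h + A * δ := by gcongr
      _ = δ * (h + A) := by ring
  rw [ENNReal.le_div_iff_mul_le (.inr (excess_ne_zero hp hδ₀)) (.inr (excess_ne_top hp hδ))]
  calc ((h ^ p⁻¹)⁻¹ + excess p δ / (h + A) ^ p⁻¹) * A ^ p⁻¹
      = (A / h) ^ p⁻¹ + excess p δ * (A / (h + A)) ^ p⁻¹ := by
        rw [ENNReal.div_rpow_of_nonneg _ _ hr.le, ENNReal.div_rpow_of_nonneg _ _ hr.le]
        simp only [div_eq_mul_inv]; ring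
    _ ≤ δ ^ p⁻¹ + excess p δ * (δ / (1 + δ)) ^ p⁻¹ := by
        gcongr
        exact ENNReal.div_le_of_le_mul hA
    _ = excess p δ := rpow_add_excess_mul hp hδ

lemma bellman_jump (hp : 0 < p) {δ l x A h : ℝ≥0∞} (hδ₀ : δ ≠ 0) (hδ : δ ≠ ∞)
    (hh : h ≠ 0) (hh' : h ≠ ∞) (hA : A ≤ δ * h) :
    bellman p (excess p δ) l x A ≤ bellman p (excess p δ) ((x / h) ^ p⁻¹ + l) x (h + A) := by
  have hr : 0 < p⁻¹ := inv_pos.2 hp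
  unfold bellman
  gcongr ((1 + excess p δ) / ?_) ^ p
  calc ((x / h) ^ p⁻¹ + l) / x ^ p⁻¹ + excess p δ / (h + A) ^ p⁻¹
      = x ^ p⁻¹ / x ^ p⁻¹ * (h ^ p⁻¹)⁻¹ + excess p δ / (h + A) ^ p⁻¹ + l / x ^ p⁻¹ := by
        rw [ENNReal.div_rpow_of_nonneg _ _ hr.le]; simp only [div_eq_mul_inv]; ring
    _ ≤ 1 * (h ^ p⁻¹)⁻¹ + excess p δ / (h + A) ^ p⁻¹ + l / x ^ p⁻¹ := by
        gcongr; exact ENNReal.div_self_le_one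
    _ ≤ l / x ^ p⁻¹ + excess p δ / A ^ p⁻¹ := by
        rw [one_mul, add_comm (l / _)]; gcongr; exact inv_add_excess_div_le hp hδ₀ hδ hh hh' hA

end Bellman

section Dyadic

lemma dyadicGen_succ (J : Interval) (k : ℕ) :
    dyadicGen J (k + 1) = dyadicGen J.left k ∪ dyadicGen J.right k := by
  induction k with
  | zero => ext K; simp [dyadicGen, or_comm]
  | succ k ih =>
    rw [dyadicGen, ih, biUnion_union]
    rfl

lemma dyadic_eq (J : Interval) : dyadic J = {J} ∪ (dyadic J.left ∪ dyadic J.right) := by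
  unfold dyadic
  rw [← iUnion_union_distrib, ← union_iUnion_nat_succ]
  simp only [dyadicGen_succ]
  rfl

lemma self_mem_dyadic (J : Interval) : J ∈ dyadic J := by
  rw [dyadic_eq]; simp

lemma dyadic_left_subset (J : Interval) : dyadic J.left ⊆ dyadic J := by
  rw [dyadic_eq J]; exact fun K hK => Or.inr (Or.inl hK)

lemma dyadic_right_subset (J : Interval) : dyadic J.right ⊆ dyadic J := by
  rw [dyadic_eq J]; exact fun K hK => Or.inr (Or.inr hK)

lemma dyadic_induction {I : Interval} {P : Interval → Prop} (h0 : P I)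
    (hl : ∀ J, P J → P J.left) (hr : ∀ J, P J → P J.right) {J : Interval} (hJ : J ∈ dyadic I) :
    P J := by
  obtain ⟨k, hk⟩ := mem_iUnion.1 hJ
  clear hJ
  induction k generalizing J with
  | zero => rwa [show J = I from hk]
  | succ k ih =>
    obtain ⟨K, hK, rfl | rfl⟩ := mem_iUnion₂.1 hk
    exacts [hl K (ih hK), hr K (ih hK)]

lemma dyadic_subset {I J : Interval} (hJ : J ∈ dyadic I) : dyadic J ⊆ dyadic I :=
  dyadic_induction (P := fun J => dyadic J ⊆ dyadic I) subset_rfl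
    (fun J h => (dyadic_left_subset J).trans h) (fun J h => (dyadic_right_subset J).trans h) hJ

lemma bounds_of_mem_dyadic {I J : Interval} (hI : I.1 < I.2) (hJ : J ∈ dyadic I) :
    I.1 ≤ J.1 ∧ J.1 < J.2 ∧ J.2 ≤ I.2 := by
  refine dyadic_induction (P := fun J => I.1 ≤ J.1 ∧ J.1 < J.2 ∧ J.2 ≤ I.2)
    ⟨le_rfl, hI, le_rfl⟩ ?_ ?_ hJ
  · rintro J ⟨h1, h2, h3⟩
    simp only [Interval.left]
    exact ⟨h1, by linarith, by linarith⟩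
  · rintro J ⟨h1, h2, h3⟩
    simp only [Interval.right]
    exact ⟨by linarith, by linarith, h3⟩

lemma left_fst_lt_snd {J : Interval} (hJ : J.1 < J.2) : J.left.1 < J.left.2 :=
  (bounds_of_mem_dyadic hJ (dyadic_left_subset J (self_mem_dyadic _))).2.1

lemma right_fst_lt_snd {J : Interval} (hJ : J.1 < J.2) : J.right.1 < J.right.2 :=
  (bounds_of_mem_dyadic hJ (dyadic_right_subset J (self_mem_dyadic _))).2.1

lemma toSet_subset_of_mem_dyadic {I J : Interval} (hI : I.1 < I.2) (hJ : J ∈ dyadic I) :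
    J.toSet ⊆ I.toSet :=
  Ico_subset_Ico (bounds_of_mem_dyadic hI hJ).1 (bounds_of_mem_dyadic hI hJ).2.2

lemma toSet_left_union_right {J : Interval} (hJ : J.1 < J.2) :
    J.left.toSet ∪ J.right.toSet = J.toSet :=
  Ico_union_Ico_eq_Ico (left_fst_lt_snd hJ).le (right_fst_lt_snd hJ).le

lemma disjoint_toSet_left_right (J : Interval) :
    Disjoint J.left.toSet J.right.toSet :=
  Ico_disjoint_Ico_same

lemma measurableSet_toSet (J : Interval) : MeasurableSet J.toSet := measurableSet_Ico

lemma notMem_dyadic_left {J : Interval} (hJ : J.1 < J.2) : J ∉ dyadic J.left := by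
  intro h
  have := (bounds_of_mem_dyadic (left_fst_lt_snd hJ) h).2.2
  simp only [Interval.left] at this
  linarith

lemma notMem_dyadic_right {J : Interval} (hJ : J.1 < J.2) : J ∉ dyadic J.right := by
  intro h
  have := (bounds_of_mem_dyadic (right_fst_lt_snd hJ) h).1
  simp only [Interval.right] at this
  linarith

lemma disjoint_dyadic_left_right {J : Interval} (hJ : J.1 < J.2) :
    Disjoint (dyadic J.left) (dyadic J.right) := by
  refine disjoint_left.2 fun K h1 h2 => ?_
  have hleft := bounds_of_mem_dyadic (left_fst_lt_snd hJ) h1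
  have hright := bounds_of_mem_dyadic (right_fst_lt_snd hJ) h2
  simp only [Interval.left, Interval.right] at hleft hright
  linarith

lemma len_left (J : Interval) : J.left.len = J.len / 2 := by
  simp only [Interval.len, Interval.left]
  rw [show (J.1 + J.2) / 2 - J.1 = (J.2 - J.1) / 2 by ring, ENNReal.ofReal_div_of_pos two_pos,
    ENNReal.ofReal_ofNat]

lemma len_right (J : Interval) : J.right.len = J.len / 2 := by
  simp only [Interval.len, Interval.right]
  rw [show J.2 - (J.1 + J.2) / 2 = (J.2 - J.1) / 2 by ring, ENNReal.ofReal_div_of_pos two_pos,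
    ENNReal.ofReal_ofNat]

lemma len_ne_zero {J : Interval} (hJ : J.1 < J.2) : J.len ≠ 0 := by
  simpa [Interval.len] using hJ

lemma len_ne_top (J : Interval) : J.len ≠ ∞ := ENNReal.ofReal_ne_top

lemma tsum_dyadic (h : Interval → ℝ≥0∞) {J : Interval} (hJ : J.1 < J.2) :
    ∑' K : dyadic J, h K = h J +
      (∑' K : dyadic J.left, h K + ∑' K : dyadic J.right, h K) := by
  rw [dyadic_eq J, ENNReal.summable.tsum_union_disjoint _ ENNReal.summable,
    ENNReal.summable.tsum_union_disjoint (disjoint_dyadic_left_right hJ) ENNReal.summable,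
    tsum_singleton]
  rw [disjoint_singleton_left]
  rintro (h | h)
  exacts [notMem_dyadic_left hJ h, notMem_dyadic_right hJ h]

lemma len_le_of_mem_dyadic {I J : Interval} (hI : I.1 < I.2) (hJ : J ∈ dyadic I) :
    J.len ≤ I.len := by
  have := bounds_of_mem_dyadic hI hJ
  exact ENNReal.ofReal_le_ofReal (by linarith)

lemma volume_toSet (J : Interval) : volume J.toSet = J.len := Real.volume_Ico

/-- The numerator `∑_{K ∈ 𝒟(J)} α_K |K|` of `packing α J`, which, unlike the quotient, is additive
over the two halves of `J`. -/
noncomputable def mass (α : Interval → ℕ) (J : Interval) : ℝ≥0∞ :=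
  ∑' K : dyadic J, (α K : ℝ≥0∞) * Interval.len K

lemma mass_eq (α : Interval → ℕ) {J : Interval} (hJ : J.1 < J.2) :
    mass α J = α J * J.len + (mass α J.left + mass α J.right) :=
  tsum_dyadic (fun K => (α K : ℝ≥0∞) * K.len) hJ

lemma packing_le_iff {α : Interval → ℕ} {J : Interval} (hJ : J.1 < J.2) {C : ℝ≥0∞} :
    packing α J ≤ C ↔ mass α J ≤ C * J.len :=
  ENNReal.div_le_iff (len_ne_zero hJ) (len_ne_top J)

lemma carleson_subset_carleson (C : ℝ≥0∞) {I J : Interval} (hJ : J ∈ dyadic I) :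
    carleson C I ⊆ carleson C J := fun _ hα =>
  ⟨fun K hK => hα.1 K (dyadic_subset hJ hK),
    (biSup_mono fun _ hK => dyadic_subset hJ hK).trans hα.2⟩

lemma packing_le_of_mem_carleson {C : ℝ≥0∞} {I : Interval} {α : Interval → ℕ}
    (hα : α ∈ carleson C I) : packing α I ≤ C :=
  iSup₂_le_iff.1 hα.2 I (self_mem_dyadic I)

lemma indicator_mem_carleson {C : ℝ≥0∞} {I : Interval} {α : Interval → ℕ}
    (hα : α ∈ carleson C I) (S : Set Interval) : S.indicator α ∈ carleson C I := by
  have hle (K : Interval) : S.indicator α K ≤ α K := indicator_le_self S α K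
  refine ⟨fun J hJ => ?_, (iSup₂_mono fun J _ => ?_).trans hα.2⟩
  · have := hle J
    have := hα.1 J hJ
    omega
  · unfold packing
    gcongr
    exact hle _

end Dyadic

section UpperBound

variable {p : ℝ} {δ : ℝ≥0∞}

lemma powerMeanSparse_eq_zero_of_notMem {J : Interval} (hJ : J.1 < J.2) (α : Interval → ℕ)
    (p : ℝ) (f : ℝ → ℝ) {t : ℝ} (ht : t ∉ J.toSet) : powerMeanSparse J α p f t = 0 :=
  ENNReal.tsum_eq_zero.2 fun K => by
    rw [indicator_of_notMem fun h => ht (toSet_subset_of_mem_dyadic hJ K.2 h), mul_zero]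

lemma powerMeanSparse_eq_of_mem {J : Interval} (hJ : J.1 < J.2) (α : Interval → ℕ)
    (p : ℝ) (f : ℝ → ℝ) {t : ℝ} (ht : t ∈ J.toSet) :
    powerMeanSparse J α p f t = α J * average (fun s => ‖f s‖ₑ ^ p) J ^ (1 / p) +
      (powerMeanSparse J.left α p f t + powerMeanSparse J.right α p f t) := by
  unfold powerMeanSparse
  rw [tsum_dyadic (fun K => (α K : ℝ≥0∞) * average (fun s => ‖f s‖ₑ ^ p) K ^ (1 / p) *
    K.toSet.indicator 1 t) hJ, indicator_of_mem ht, Pi.one_apply, mul_one]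

lemma volume_superlevel_le {J : Interval} (hJ : J.1 < J.2) (α : Interval → ℕ)
    (p : ℝ) (f : ℝ → ℝ) (l : ℝ≥0∞) :
    let l' := l - α J * average (fun s => ‖f s‖ₑ ^ p) J ^ (1 / p)
    volume {t ∈ J.toSet | l ≤ powerMeanSparse J α p f t} ≤
      volume {t ∈ J.left.toSet | l' ≤ powerMeanSparse J.left α p f t} +
        volume {t ∈ J.right.toSet | l' ≤ powerMeanSparse J.right α p f t} := by
  intro l'
  refine (measure_mono ?_).trans (measure_union_le _ _)
  rintro t ⟨ht, hlt⟩
  rw [powerMeanSparse_eq_of_mem hJ _ _ _ ht, ← tsub_le_iff_left] at hlt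
  rw [← toSet_left_union_right hJ] at ht
  have hdisj := disjoint_toSet_left_right J
  rcases ht with ht | ht
  · rw [powerMeanSparse_eq_zero_of_notMem (right_fst_lt_snd hJ) _ _ _ (disjoint_left.1 hdisj ht),
      add_zero] at hlt
    exact .inl ⟨ht, hlt⟩
  · rw [powerMeanSparse_eq_zero_of_notMem (left_fst_lt_snd hJ) _ _ _ (disjoint_right.1 hdisj ht),
      zero_add] at hlt
    exact .inr ⟨ht, hlt⟩

lemma mass_left_add_mass_right_le {J : Interval} (hJ : J.1 < J.2) {α : Interval → ℕ}
    (hα : α ∈ carleson (1 + δ) J) (h1 : α J = 1) :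
    mass α J.left + mass α J.right ≤ δ * J.len := by
  have := (packing_le_iff hJ).1 (packing_le_of_mem_carleson hα)
  rw [mass_eq α hJ, h1, Nat.cast_one, add_mul] at this
  exact (ENNReal.add_le_add_iff_left (by simpa using len_ne_top J)).1 this

lemma volume_superlevel_le_bellman_of_children (hp : 0 < p) (hδ₀ : δ ≠ 0)
    (hδ : δ ≠ ∞) (f : ℝ → ℝ) {J : Interval} (hJ : J.1 < J.2) {α : Interval → ℕ}
    (hα : α ∈ carleson (1 + δ) J)
    (children : ∀ l ≠ 0, volume {t ∈ J.left.toSet | l ≤ powerMeanSparse J.left α p f t} +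
        volume {t ∈ J.right.toSet | l ≤ powerMeanSparse J.right α p f t} ≤
      bellman p (excess p δ) l (∫⁻ t in J.toSet, ‖f t‖ₑ ^ p) (mass α J.left + mass α J.right))
    {l : ℝ≥0∞} (hl : l ≠ 0) :
    volume {t ∈ J.toSet | l ≤ powerMeanSparse J α p f t} ≤
      bellman p (excess p δ) l (∫⁻ t in J.toSet, ‖f t‖ₑ ^ p) (mass α J) := by
  have hsplit := volume_superlevel_le hJ α p f l
  rcases hα.1 J (self_mem_dyadic J) with h0 | h1
  · simp only [h0, Nat.cast_zero, zero_mul, tsub_zero] at hsplit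
    simpa [mass_eq α hJ, h0] using hsplit.trans (children l hl)
  have hmass : mass α J = J.len + (mass α J.left + mass α J.right) := by
    rw [mass_eq α hJ, h1, Nat.cast_one, one_mul]
  simp only [h1, Nat.cast_one, one_mul, average, one_div] at hsplit
  set x := ∫⁻ t in J.toSet, ‖f t‖ₑ ^ p
  rcases le_or_gt l ((x / J.len) ^ p⁻¹) with hlx | hlx
  · calc volume {t ∈ J.toSet | l ≤ powerMeanSparse J α p f t}
        ≤ volume J.toSet := measure_mono (sep_subset _ _)
      _ = J.len := volume_toSet J
      _ ≤ _ := le_bellman_of_le hp (excess_ne_top hp hδ) (len_ne_zero hJ) (len_ne_top J)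
        (hmass ▸ le_self_add) hlx
  · refine (hsplit.trans (children _ (tsub_pos_of_lt hlx).ne')).trans ?_
    rw [hmass]
    conv_rhs => rw [← add_tsub_cancel_of_le hlx.le]
    exact bellman_jump hp hδ₀ hδ (len_ne_zero hJ) (len_ne_top J)
      (mass_left_add_mass_right_le hJ hα h1)

lemma volume_superlevel_le_bellman_of_truncated (hp : 0 < p) {δ : ℝ≥0∞}
    (hδ₀ : δ ≠ 0) (hδ : δ ≠ ∞) (f : ℝ → ℝ) (n : ℕ) {J : Interval} (hJ : J.1 < J.2)
    {α : Interval → ℕ} (hα : α ∈ carleson (1 + δ) J)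
    (hn : ∀ K ∈ dyadic J, α K ≠ 0 → J.len < 2 ^ n * K.len) {l : ℝ≥0∞} (hl : l ≠ 0) :
    volume {t ∈ J.toSet | l ≤ powerMeanSparse J α p f t} ≤
      bellman p (excess p δ) l (∫⁻ t in J.toSet, ‖f t‖ₑ ^ p) (mass α J) := by
  induction n generalizing J l with
  | zero =>
    have hzero (t : ℝ) : powerMeanSparse J α p f t = 0 := by
      refine ENNReal.tsum_eq_zero.2 fun K => ?_
      have : α K = 0 := by
        by_contra hK
        have := hn K K.2 hK
        rw [pow_zero, one_mul] at this
        exact this.not_ge (len_le_of_mem_dyadic hJ K.2)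
      simp [this]
    simp [hzero, hl]
  | succ n ih =>
    have hleft := dyadic_left_subset J (self_mem_dyadic J.left)
    have hright := dyadic_right_subset J (self_mem_dyadic J.right)
    refine volume_superlevel_le_bellman_of_children hp hδ₀ hδ f hJ hα (fun l hl => ?_) hl
    rw [← toSet_left_union_right hJ,
      lintegral_union (measurableSet_toSet _) (disjoint_toSet_left_right J)]
    refine (add_le_add (ih (left_fst_lt_snd hJ) (carleson_subset_carleson _ hleft hα) ?_ hl)
      (ih (right_fst_lt_snd hJ) (carleson_subset_carleson _ hright hα) ?_ hl)).trans
      (bellman_add_le hp (excess_ne_top hp hδ) _ _ _ _ _)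
    · intro K hK hαK
      rw [len_left]
      exact ENNReal.div_lt_of_lt_mul (by
        simpa only [pow_succ, mul_right_comm] using hn K (dyadic_left_subset J hK) hαK)
    · intro K hK hαK
      rw [len_right]
      exact ENNReal.div_lt_of_lt_mul (by
        simpa only [pow_succ, mul_right_comm] using hn K (dyadic_right_subset J hK) hαK)

/-- The restriction of `α` to the intervals longer than `2⁻ⁿ|I|`; on `𝒟(I)` these are exactly the
first `n` generations. -/
noncomputable def truncate (n : ℕ) (I : Interval) (α : Interval → ℕ) : Interval → ℕ :=
  {K | I.len < 2 ^ n * K.len}.indicator α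

lemma truncate_mono (I : Interval) (α : Interval → ℕ) : Monotone fun n => truncate n I α := by
  intro m n hmn
  have hsub : {K : Interval | I.len < 2 ^ m * K.len} ⊆ {K | I.len < 2 ^ n * K.len} :=
    fun K hK => lt_of_lt_of_le (b := 2 ^ m * K.len) hK (by gcongr; exact one_le_two)
  exact indicator_le_indicator_of_subset hsub fun K => Nat.zero_le (α K)

lemma eventually_truncate_eq {I : Interval} (α : Interval → ℕ) {K : Interval} (hK : K.1 < K.2) :
    ∀ᶠ n in Filter.atTop, truncate n I α K = α K := by
  obtain ⟨N, hN⟩ := ENNReal.exists_nat_gt (ENNReal.div_ne_top (len_ne_top I) (len_ne_zero hK))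
  filter_upwards [Filter.eventually_ge_atTop N] with n hn
  refine indicator_of_mem (s := {K | I.len < 2 ^ n * K.len}) ?_ α
  rw [mem_ofPred_eq, ← ENNReal.div_lt_iff (.inl (len_ne_zero hK)) (.inl (len_ne_top K))]
  exact hN.trans_le (by exact_mod_cast hn.trans Nat.lt_two_pow_self.le)

lemma exists_lt_powerMeanSparse_truncate {I : Interval} (hI : I.1 < I.2) {α : Interval → ℕ}
    {f : ℝ → ℝ} {t : ℝ} {l : ℝ≥0∞} (hl : l < powerMeanSparse I α p f t) :
    ∃ n, l < powerMeanSparse I (truncate n I α) p f t := by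
  rw [powerMeanSparse, ENNReal.tsum_eq_iSup_sum, lt_iSup_iff] at hl
  obtain ⟨s, hs⟩ := hl
  obtain ⟨n, hn⟩ := ((Filter.eventually_all_finset s).2 fun K _ =>
    eventually_truncate_eq (I := I) α (bounds_of_mem_dyadic hI K.2).2.1).exists
  refine ⟨n, hs.trans_le (le_trans ?_ (ENNReal.sum_le_tsum s))⟩
  exact (Finset.sum_congr rfl fun K hK => by rw [hn K hK]).le

lemma powerMeanSparse_mono (I : Interval) (p : ℝ) (f : ℝ → ℝ) (t : ℝ) :
    Monotone fun α => powerMeanSparse I α p f t := by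
  intro α β h
  refine ENNReal.tsum_le_tsum fun K => ?_
  gcongr
  exact h K

lemma mul_volume_superlevel_truncate_le (hp : 0 < p) (hδ₀ : δ ≠ 0)
    (hδ : δ ≠ ∞) {I : Interval} (hI : I.1 < I.2) {α : Interval → ℕ}
    (hα : α ∈ carleson (1 + δ) I) (f : ℝ → ℝ) (n : ℕ) (l : ℝ≥0∞) :
    l * volume {t ∈ I.toSet | l ≤ powerMeanSparse I (truncate n I α) p f t} ^ p⁻¹ ≤
      (1 + excess p δ) * (∫⁻ t in I.toSet, ‖f t‖ₑ ^ p) ^ p⁻¹ := by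
  rcases eq_or_ne l 0 with rfl | hl
  · simp
  have hlong (K : Interval) (_ : K ∈ dyadic I) (hK : truncate n I α K ≠ 0) :
      I.len < 2 ^ n * K.len :=
    mem_of_indicator_ne_zero (s := {K : Interval | I.len < 2 ^ n * K.len}) hK
  exact mul_rpow_le_of_le_bellman hp (excess_ne_top hp hδ)
    (volume_superlevel_le_bellman_of_truncated hp hδ₀ hδ f n hI (indicator_mem_carleson hα _)
      hlong hl)

lemma mul_volume_superlevel_le (hp : 0 < p) (hδ₀ : δ ≠ 0)
    (hδ : δ ≠ ∞) {I : Interval} (hI : I.1 < I.2) {α : Interval → ℕ}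
    (hα : α ∈ carleson (1 + δ) I) (f : ℝ → ℝ) (l : ℝ≥0∞) :
    l * volume {t ∈ I.toSet | l ≤ powerMeanSparse I α p f t} ^ p⁻¹ ≤
      (1 + excess p δ) * (∫⁻ t in I.toSet, ‖f t‖ₑ ^ p) ^ p⁻¹ := by
  -- `{l ≤ 𝒬f}` need not be the union of the truncated superlevel sets, only of those at `l' < l`.
  refine ENNReal.mul_le_of_forall_lt fun l' hl' v hv => ?_
  have hmono : Monotone fun n => {t ∈ I.toSet | l' ≤ powerMeanSparse I (truncate n I α) p f t} :=
    fun m n hmn t ht =>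
      ⟨ht.1, ht.2.trans (powerMeanSparse_mono I p f t (truncate_mono I α hmn))⟩
  have hsub : {t ∈ I.toSet | l ≤ powerMeanSparse I α p f t} ⊆
      ⋃ n, {t ∈ I.toSet | l' ≤ powerMeanSparse I (truncate n I α) p f t} := fun t ht => by
    obtain ⟨n, hn⟩ := exists_lt_powerMeanSparse_truncate hI (hl'.trans_le ht.2)
    exact mem_iUnion.2 ⟨n, ht.1, hn.le⟩
  have hv' := (ENNReal.lt_rpow_inv_iff hp).1 hv |>.trans_le (measure_mono hsub)
  rw [hmono.measure_iUnion, lt_iSup_iff] at hv'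
  obtain ⟨n, hn⟩ := hv'
  calc l' * v ≤ l' * volume {t ∈ I.toSet | l' ≤ powerMeanSparse I (truncate n I α) p f t} ^ p⁻¹ :=
        by gcongr; exact (ENNReal.le_rpow_inv_iff hp).2 hn.le
    _ ≤ _ := mul_volume_superlevel_truncate_le hp hδ₀ hδ hI hα f n l'

lemma weakTypeNorm_powerMeanSparse_le (hp : 0 < p) (hδ₀ : δ ≠ 0)
    (hδ : δ ≠ ∞) {I : Interval} (hI : I.1 < I.2) {α : Interval → ℕ}
    (hα : α ∈ carleson (1 + δ) I) :
    weakTypeNorm I p (powerMeanSparse I α p) ≤ 1 + excess p δ := by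
  refine sInf_le fun f _ => iSup₂_le fun l _ => ?_
  rw [eLpNorm_eq_lintegral_rpow_enorm_toReal (by simpa using hp) ENNReal.ofReal_ne_top,
    ENNReal.toReal_ofReal hp.le, one_div]
  exact mul_volume_superlevel_le hp hδ₀ hδ hI hα f _

end UpperBound

section LowerBound

variable {p : ℝ}

lemma mem_carleson_of_children {C : ℝ≥0∞} {J : Interval} (hJ : J.1 < J.2) {α : Interval → ℕ}
    (h01 : α J = 0 ∨ α J = 1) (hmass : mass α J ≤ C * J.len)
    (hleft : α ∈ carleson C J.left) (hright : α ∈ carleson C J.right) : α ∈ carleson C J := by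
  unfold carleson at *
  rw [dyadic_eq J, mem_ofPred_eq, iSup_union, iSup_union, iSup_singleton]
  refine ⟨?_, sup_le ((packing_le_iff hJ).2 hmass) (sup_le hleft.2 hright.2)⟩
  rintro K (rfl | hK | hK)
  exacts [h01, hleft.1 K hK, hright.1 K hK]

lemma mass_eq_zero {J : Interval} {α : Interval → ℕ} (h : EqOn α 0 (dyadic J)) :
    mass α J = 0 :=
  ENNReal.tsum_eq_zero.2 fun K => by simp [h K.2]

lemma mem_carleson_of_eqOn_zero (C : ℝ≥0∞) {J : Interval} {α : Interval → ℕ}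
    (h : EqOn α 0 (dyadic J)) : α ∈ carleson C J := by
  refine ⟨fun K hK => .inl (h hK), iSup₂_le fun K hK => ?_⟩
  change mass α K / K.len ≤ C
  simp [mass_eq_zero (h.mono (dyadic_subset hK))]

lemma eqOn_children_of_eqOn_insert_union {I : Interval} (hI : I.1 < I.2) {L R : Set Interval}
    (hL : L ⊆ dyadic I.left) (hR : R ⊆ dyadic I.right) {α : Interval → ℕ}
    (h : EqOn α ((insert I (L ∪ R)).indicator 1) (dyadic I)) :
    α I = 1 ∧ EqOn α (L.indicator 1) (dyadic I.left) ∧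
      EqOn α (R.indicator 1) (dyadic I.right) := by
  classical
  have hdisj := disjoint_left.1 (disjoint_dyadic_left_right hI)
  refine ⟨by simp [h (self_mem_dyadic I)], fun K hK => ?_, fun K hK => ?_⟩
  · have hKI : K ≠ I := by rintro rfl; exact notMem_dyadic_left hI hK
    have hKR : K ∉ R := fun hKR => hdisj hK (hR hKR)
    rw [h (dyadic_left_subset I hK)]
    simp [indicator_apply, hKI, hKR]
  · have hKI : K ≠ I := by rintro rfl; exact notMem_dyadic_right hI hK
    have hKL : K ∉ L := fun hKL => hdisj (hL hKL) hK
    rw [h (dyadic_right_subset I hK)]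
    simp [indicator_apply, hKI, hKL]

lemma eqOn_zero_children_of_eqOn_singleton {J : Interval} (hJ : J.1 < J.2) {α : Interval → ℕ}
    (h : EqOn α (indicator {J} 1) (dyadic J)) :
    α J = 1 ∧ EqOn α 0 (dyadic J.left) ∧ EqOn α 0 (dyadic J.right) := by
  have := eqOn_children_of_eqOn_insert_union (L := ∅) (R := ∅) hJ (empty_subset _)
    (empty_subset _) (by simpa only [union_self, insert_empty_eq] using h)
  rwa [indicator_empty'] at this

lemma mass_of_eqOn_singleton {J : Interval} (hJ : J.1 < J.2) {α : Interval → ℕ}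
    (h : EqOn α (indicator {J} 1) (dyadic J)) : mass α J = J.len := by
  obtain ⟨h1, hleft, hright⟩ := eqOn_zero_children_of_eqOn_singleton hJ h
  simp [mass_eq α hJ, h1, mass_eq_zero hleft, mass_eq_zero hright]

lemma mem_carleson_of_eqOn_singleton {C : ℝ≥0∞} (hC : 1 ≤ C) {J : Interval} (hJ : J.1 < J.2)
    {α : Interval → ℕ} (h : EqOn α (indicator {J} 1) (dyadic J)) : α ∈ carleson C J := by
  obtain ⟨h1, hleft, hright⟩ := eqOn_zero_children_of_eqOn_singleton hJ h
  refine mem_carleson_of_children hJ (.inr h1) ?_ (mem_carleson_of_eqOn_zero C hleft)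
    (mem_carleson_of_eqOn_zero C hright)
  rw [mass_of_eqOn_singleton hJ h]
  exact le_mul_of_one_le_left' hC

/-- The support of the sequence that is nearly extremal for the weak-type bound: `I`, its first `n`
successive left halves, and both halves of the last of them. The union with `∅` gives the two cases
the same shape. -/
def extremalFamily : ℕ → Interval → Set Interval
  | 0, I => insert I ({I.left} ∪ {I.right})
  | n + 1, I => insert I (extremalFamily n I.left ∪ ∅)

lemma extremalFamily_subset_dyadic (n : ℕ) (I : Interval) : extremalFamily n I ⊆ dyadic I := by
  induction n generalizing I with
  | zero =>
    exact insert_subset (self_mem_dyadic I) (union_subset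
      (singleton_subset_iff.2 (dyadic_left_subset I (self_mem_dyadic _)))
      (singleton_subset_iff.2 (dyadic_right_subset I (self_mem_dyadic _))))
  | succ n ih =>
    exact insert_subset (self_mem_dyadic I)
      (union_subset ((ih I.left).trans (dyadic_left_subset I)) (empty_subset _))

lemma eqOn_extremalFamily_zero {I : Interval} (hI : I.1 < I.2) {α : Interval → ℕ}
    (h : EqOn α ((extremalFamily 0 I).indicator 1) (dyadic I)) :
    α I = 1 ∧ EqOn α (indicator {I.left} 1) (dyadic I.left) ∧
      EqOn α (indicator {I.right} 1) (dyadic I.right) :=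
  eqOn_children_of_eqOn_insert_union hI (by simp [self_mem_dyadic]) (by simp [self_mem_dyadic]) h

lemma eqOn_extremalFamily_succ {I : Interval} (hI : I.1 < I.2) {n : ℕ} {α : Interval → ℕ}
    (h : EqOn α ((extremalFamily (n + 1) I).indicator 1) (dyadic I)) :
    α I = 1 ∧ EqOn α ((extremalFamily n I.left).indicator 1) (dyadic I.left) ∧
      EqOn α 0 (dyadic I.right) := by
  have := eqOn_children_of_eqOn_insert_union hI (extremalFamily_subset_dyadic n I.left)
    (empty_subset _) h
  rwa [indicator_empty'] at this

lemma mass_of_eqOn_extremalFamily (n : ℕ) {I : Interval} (hI : I.1 < I.2) {α : Interval → ℕ}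
    (h : EqOn α ((extremalFamily n I).indicator 1) (dyadic I)) : mass α I = 2 * I.len := by
  induction n generalizing I with
  | zero =>
    obtain ⟨h1, hleft, hright⟩ := eqOn_extremalFamily_zero hI h
    rw [mass_eq α hI, h1, mass_of_eqOn_singleton (left_fst_lt_snd hI) hleft,
      mass_of_eqOn_singleton (right_fst_lt_snd hI) hright, len_left, len_right, ENNReal.add_halves,
      Nat.cast_one, one_mul, two_mul]
  | succ n ih =>
    obtain ⟨h1, hleft, hright⟩ := eqOn_extremalFamily_succ hI h
    rw [mass_eq α hI, h1, ih (left_fst_lt_snd hI) hleft, mass_eq_zero hright, len_left,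
      ENNReal.mul_div_cancel two_ne_zero ENNReal.ofNat_ne_top, Nat.cast_one, one_mul, add_zero,
      two_mul]

lemma mem_carleson_of_eqOn_extremalFamily (n : ℕ) {I : Interval} (hI : I.1 < I.2)
    {α : Interval → ℕ} (h : EqOn α ((extremalFamily n I).indicator 1) (dyadic I)) :
    α ∈ carleson 2 I := by
  have hmass := (mass_of_eqOn_extremalFamily n hI h).le
  induction n generalizing I with
  | zero =>
    obtain ⟨h1, hleft, hright⟩ := eqOn_extremalFamily_zero hI h
    exact mem_carleson_of_children hI (.inr h1) hmass
      (mem_carleson_of_eqOn_singleton one_le_two (left_fst_lt_snd hI) hleft)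
      (mem_carleson_of_eqOn_singleton one_le_two (right_fst_lt_snd hI) hright)
  | succ n ih =>
    obtain ⟨h1, hleft, hright⟩ := eqOn_extremalFamily_succ hI h
    exact mem_carleson_of_children hI (.inr h1) hmass
      (ih (left_fst_lt_snd hI) hleft (mass_of_eqOn_extremalFamily n (left_fst_lt_snd hI) hleft).le)
      (mem_carleson_of_eqOn_zero 2 hright)

lemma iterate_left_mem_dyadic (n : ℕ) (I : Interval) : Interval.left^[n] I ∈ dyadic I := by
  induction n generalizing I with
  | zero => exact self_mem_dyadic I
  | succ n ih => exact dyadic_left_subset I (ih _)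

lemma len_iterate_left (n : ℕ) (I : Interval) :
    (Interval.left^[n] I).len = 2⁻¹ ^ n * I.len := by
  induction n with
  | zero => simp
  | succ n ih =>
    rw [Function.iterate_succ_apply', len_left, ih, pow_succ, div_eq_mul_inv]
    ring

lemma average_indicator (hp : 0 < p) {E : Set ℝ} (hE : MeasurableSet E) (J : Interval) :
    average (fun s => ‖E.indicator (1 : ℝ → ℝ) s‖ₑ ^ p) J = volume (E ∩ J.toSet) / J.len := by
  have : (fun s => ‖E.indicator (1 : ℝ → ℝ) s‖ₑ ^ p) = E.indicator 1 := by
    funext s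
    by_cases hs : s ∈ E <;> simp [hs, hp]
  rw [average, this, lintegral_indicator_one hE, Measure.restrict_apply hE]

lemma average_indicator_of_subset (hp : 0 < p) {E : Set ℝ} (hE : MeasurableSet E)
    {J : Interval} (hJ : J.1 < J.2) (hJE : J.toSet ⊆ E) :
    average (fun s => ‖E.indicator (1 : ℝ → ℝ) s‖ₑ ^ p) J = 1 := by
  rw [average_indicator hp hE, inter_eq_right.2 hJE, volume_toSet,
    ENNReal.div_self (len_ne_zero hJ) (len_ne_top J)]

lemma average_indicator_iterate_left (hp : 0 < p) (n : ℕ) {I : Interval}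
    (hI : I.1 < I.2) :
    average (fun s => ‖(Interval.left^[n] I).toSet.indicator (1 : ℝ → ℝ) s‖ₑ ^ p) I =
      2⁻¹ ^ n := by
  rw [average_indicator hp (measurableSet_toSet _),
    inter_eq_left.2 (toSet_subset_of_mem_dyadic hI (iterate_left_mem_dyadic n I)), volume_toSet,
    len_iterate_left, ENNReal.mul_div_cancel_right (len_ne_zero hI) (len_ne_top I)]

lemma average_rpow_le_powerMeanSparse {J : Interval} (hJ : J.1 < J.2) {α : Interval → ℕ}
    (h1 : α J = 1) (p : ℝ) (f : ℝ → ℝ) {t : ℝ} (ht : t ∈ J.toSet) :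
    average (fun s => ‖f s‖ₑ ^ p) J ^ (1 / p) ≤ powerMeanSparse J α p f t := by
  rw [powerMeanSparse_eq_of_mem hJ _ _ _ ht, h1, Nat.cast_one, one_mul]
  exact le_self_add

lemma two_le_powerMeanSparse_indicator_self (hp : 0 < p) {I : Interval} (hI : I.1 < I.2)
    {α : Interval → ℕ} (h1 : α I = 1) (hleft : α I.left = 1) (hright : α I.right = 1) {t : ℝ}
    (ht : t ∈ I.toSet) : 2 ≤ powerMeanSparse I α p (I.toSet.indicator 1) t := by
  have average_one {J : Interval} (hJ : J ∈ dyadic I) :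
      average (fun s => ‖I.toSet.indicator (1 : ℝ → ℝ) s‖ₑ ^ p) J = 1 :=
    average_indicator_of_subset hp (measurableSet_toSet I) (bounds_of_mem_dyadic hI hJ).2.1
      (toSet_subset_of_mem_dyadic hI hJ)
  rw [powerMeanSparse_eq_of_mem hI _ _ _ ht, h1, average_one (self_mem_dyadic I),
    ENNReal.one_rpow, Nat.cast_one, one_mul, ← one_add_one_eq_two]
  gcongr
  rcases (toSet_left_union_right hI).symm ▸ ht with ht | ht
  · have := average_rpow_le_powerMeanSparse (left_fst_lt_snd hI) hleft p (I.toSet.indicator 1) ht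
    rw [average_one (dyadic_left_subset I (self_mem_dyadic _)), ENNReal.one_rpow] at this
    exact this.trans le_self_add
  · have := average_rpow_le_powerMeanSparse (right_fst_lt_snd hI) hright p (I.toSet.indicator 1) ht
    rw [average_one (dyadic_right_subset I (self_mem_dyadic _)), ENNReal.one_rpow] at this
    exact this.trans le_add_self

lemma le_powerMeanSparse_extremalFamily (hp : 0 < p) (n : ℕ) {I : Interval}
    (hI : I.1 < I.2) {α : Interval → ℕ}
    (h : EqOn α ((extremalFamily n I).indicator 1) (dyadic I)) {t : ℝ}
    (ht : t ∈ (Interval.left^[n] I).toSet) :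
    1 + ∑ k ∈ Finset.range (n + 1), ((2⁻¹ : ℝ≥0∞) ^ p⁻¹) ^ k ≤
      powerMeanSparse I α p ((Interval.left^[n] I).toSet.indicator 1) t := by
  induction n generalizing I with
  | zero =>
    obtain ⟨h1, hleft, hright⟩ := eqOn_extremalFamily_zero hI h
    simpa [one_add_one_eq_two] using two_le_powerMeanSparse_indicator_self hp hI h1
      (by simpa using hleft (self_mem_dyadic _)) (by simpa using hright (self_mem_dyadic _)) ht
  | succ n ih =>
    obtain ⟨h1, hleft, -⟩ := eqOn_extremalFamily_succ hI h
    have htI : t ∈ I.toSet := toSet_subset_of_mem_dyadic hI (iterate_left_mem_dyadic (n + 1) I) ht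
    rw [powerMeanSparse_eq_of_mem hI _ _ _ htI, h1, average_indicator_iterate_left hp _ hI,
      Finset.sum_range_succ, ← add_assoc, add_comm, Nat.cast_one, one_mul, one_div]
    refine add_le_add (le_of_eq ?_) ((ih (left_fst_lt_snd hI) hleft ht).trans le_self_add)
    rw [← ENNReal.rpow_mul_natCast, mul_comm, ENNReal.rpow_natCast_mul]

lemma mul_volume_rpow_le_weakNorm (hp : 0 < p) {I : Interval} {E : Set ℝ}
    (hEI : E ⊆ I.toSet) {g : ℝ → ℝ≥0∞} {l : ℝ≥0∞} (hg : ∀ t ∈ E, l ≤ g t) :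
    l * volume E ^ (1 / p) ≤ weakNorm I p g := by
  refine ENNReal.mul_le_of_forall_lt fun r hr v hv => ?_
  rcases eq_or_ne r 0 with rfl | hr₀
  · simp
  have hr_pos : 0 < r.toReal := ENNReal.toReal_pos hr₀ hr.ne_top
  refine le_iSup₂_of_le r.toReal hr_pos ?_
  rw [ENNReal.ofReal_toReal hr.ne_top]
  have hsub : E ⊆ {t ∈ I.toSet | r ≤ g t} := fun t ht => ⟨hEI ht, hr.le.trans (hg t ht)⟩
  gcongr
  exact hv.le.trans (ENNReal.rpow_le_rpow (measure_mono hsub) (one_div_pos.2 hp).le)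

lemma le_weakTypeNorm_of_le_on_indicator (hp : 0 < p) {I : Interval} {E : Set ℝ}
    (hE : MeasurableSet E) (hEI : E ⊆ I.toSet) (hE₀ : volume E ≠ 0)
    {T : (ℝ → ℝ) → ℝ → ℝ≥0∞} {l : ℝ≥0∞} (hT : ∀ t ∈ E, l ≤ T (E.indicator 1) t) :
    l ≤ weakTypeNorm I p T := by
  have hvol : volume.restrict I.toSet E = volume E := by
    rw [Measure.restrict_apply hE, inter_eq_left.2 hEI]
  have hE_top : volume E ≠ ∞ := measure_ne_top_of_subset hEI (volume_toSet I ▸ len_ne_top I)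
  have hmem : MemLp (E.indicator (1 : ℝ → ℝ)) (ENNReal.ofReal p) (volume.restrict I.toSet) :=
    memLp_indicator_const _ hE (1 : ℝ) (.inr (hvol ▸ hE_top))
  have hnorm : eLpNorm (E.indicator (1 : ℝ → ℝ)) (ENNReal.ofReal p) (volume.restrict I.toSet) =
      volume E ^ (1 / p) := by
    have := eLpNorm_indicator_const (μ := volume.restrict I.toSet) (c := (1 : ℝ)) hE
      (by simpa using hp) (ENNReal.ofReal_ne_top (r := p))
    rwa [hvol, ENNReal.toReal_ofReal hp.le, enorm_one, one_mul] at this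
  refine le_sInf fun c hc => ?_
  have hle : l * volume E ^ (1 / p) ≤ c * volume E ^ (1 / p) :=
    hnorm ▸ (mul_volume_rpow_le_weakNorm hp hEI hT).trans (hc _ hmem)
  exact (ENNReal.mul_le_mul_iff_left (by simp [hE₀, hE_top])
    (ENNReal.rpow_ne_top_of_nonneg (one_div_pos.2 hp).le hE_top)).1 hle

lemma excess_one_eq_tsum (p : ℝ) : excess p 1 = ∑' k : ℕ, ((2⁻¹ : ℝ≥0∞) ^ p⁻¹) ^ k := by
  rw [excess, ENNReal.tsum_geometric, ENNReal.one_rpow, one_add_one_eq_two, one_div, one_div]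

lemma one_add_excess_le_iSup (hp : 0 < p) {I : Interval} (hI : I.1 < I.2) :
    1 + excess p 1 ≤ ⨆ α ∈ carleson 2 I, weakTypeNorm I p (powerMeanSparse I α p) := by
  rw [excess_one_eq_tsum, ENNReal.tsum_eq_iSup_nat' (Filter.tendsto_add_atTop_nat 1),
    ENNReal.add_iSup]
  refine iSup_le fun n => ?_
  have hn := eqOn_refl ((extremalFamily n I).indicator (1 : Interval → ℕ)) (dyadic I)
  have hmem := iterate_left_mem_dyadic n I
  refine le_iSup₂_of_le _ (mem_carleson_of_eqOn_extremalFamily n hI hn) ?_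
  exact le_weakTypeNorm_of_le_on_indicator hp (measurableSet_toSet (Interval.left^[n] I))
    (toSet_subset_of_mem_dyadic hI hmem)
    (volume_toSet _ ▸ len_ne_zero (bounds_of_mem_dyadic hI hmem).2.1)
    fun t ht => le_powerMeanSparse_extremalFamily hp n hI hn ht

end LowerBound

lemma sharpConst_rpow {p : ℝ} (hp : 0 < p) :
    sharpConst (1 / p) ^ (1 / p) =
      (2 * (2 : ℝ) ^ (1 / p) - 1) / ((2 : ℝ) ^ (1 / p) - 1) := by
  have hu : 1 < (2 : ℝ) ^ (1 / p) := Real.one_lt_rpow one_lt_two (one_div_pos.2 hp)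
  rw [sharpConst, one_div_one_div, Real.rpow_add two_pos, Real.rpow_one, mul_comm _ (2 : ℝ),
    ← Real.rpow_mul (div_nonneg (by linarith) (by linarith)), mul_one_div_cancel hp.ne',
    Real.rpow_one]

lemma one_add_excess_one_eq_ofReal_sharpConst {p : ℝ} (hp : 0 < p) :
    1 + excess p 1 = ENNReal.ofReal (sharpConst (1 / p) ^ (1 / p)) := by
  have hu : 1 < (2 : ℝ) ^ p⁻¹ := Real.one_lt_rpow one_lt_two (inv_pos.2 hp)
  have hu' : 0 < (2 : ℝ) ^ p⁻¹ := one_pos.trans hu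
  have hinv : ((2 : ℝ) ^ p⁻¹)⁻¹ < 1 := inv_lt_one_of_one_lt₀ hu
  have hratio : (2⁻¹ : ℝ≥0∞) ^ p⁻¹ = ENNReal.ofReal ((2 : ℝ) ^ p⁻¹)⁻¹ := by
    rw [ENNReal.inv_rpow, ENNReal.ofReal_inv_of_pos hu', ← ENNReal.ofReal_rpow_of_pos two_pos,
      ENNReal.ofReal_ofNat]
  rw [sharpConst_rpow hp, excess_one_eq_tsum, ENNReal.tsum_geometric, hratio, ← ENNReal.ofReal_one,
    ← ENNReal.ofReal_sub _ (inv_pos.2 hu').le, ← ENNReal.ofReal_inv_of_pos (sub_pos.2 hinv),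
    ← ENNReal.ofReal_add zero_le_one (inv_pos.2 (sub_pos.2 hinv)).le, one_div]
  congr 1
  generalize (2 : ℝ) ^ p⁻¹ = u at hu hu'
  have := sub_ne_zero.2 hu.ne'
  field_simp
  ring

end PowerMeanSparse

theorem mainTheorem3_general (a b : ℝ) (hab : a < b) (p : ℝ) (hp : 0 < p) :
    (⨆ α ∈ PowerMeanSparse.carleson 2 (a, b),
        PowerMeanSparse.weakTypeNorm (a, b) p
          (PowerMeanSparse.powerMeanSparse (a, b) α p)) =
      ENNReal.ofReal (PowerMeanSparse.sharpConst (1 / p) ^ (1 / p)) ∧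
    PowerMeanSparse.sharpConst (1 / p) ^ (1 / p) =
      (2 * (2 : ℝ) ^ (1 / p) - 1) / ((2 : ℝ) ^ (1 / p) - 1) := by
  refine ⟨?_, PowerMeanSparse.sharpConst_rpow hp⟩
  rw [← PowerMeanSparse.one_add_excess_one_eq_ofReal_sharpConst hp]
  refine le_antisymm (iSup₂_le fun α hα => ?_) (PowerMeanSparse.one_add_excess_le_iSup hp hab)
  rw [← one_add_one_eq_two] at hα
  exact PowerMeanSparse.weakTypeNorm_powerMeanSparse_le hp one_ne_zero ENNReal.one_ne_top hab hα

theorem mainTheorem3 (a b : ℝ) (hab : a < b) (p : ℝ) (hp : 1 ≤ p) :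
    (⨆ α ∈ PowerMeanSparse.carleson 2 (a, b),
        PowerMeanSparse.weakTypeNorm (a, b) p
          (PowerMeanSparse.powerMeanSparse (a, b) α p)) =
      ENNReal.ofReal (PowerMeanSparse.sharpConst (1 / p) ^ (1 / p)) ∧
    PowerMeanSparse.sharpConst (1 / p) ^ (1 / p) =
      (2 * (2 : ℝ) ^ (1 / p) - 1) / ((2 : ℝ) ^ (1 / p) - 1) :=
  mainTheorem3_general a b hab p (zero_lt_one.trans_le hp)
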